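/- Let $d\ge 1$ be an integer. For $h>0$ and $f:(h\mathbb Z)^d\to\mathbb C$ write $f_j=f(hj)$, $j\in\mathbb Z^d$, and $$\Delta_{\mathrm d} f_j=\frac1{h^2}\sum_{k=1}^d\big(f_{j+e_k}-2f_j+f_{j-e_k}\big),\qquad \|f\|_\infty=\sup_{j}|f_j|,\qquad \|f\|_2=\Big(h^d\sum_{j\in\mathbb Z^d}|f_j|^2\Big)^{1/2},$$ where $e_k$ is the $k$-th unit vector. Let $|\cdot|$ also denote the Euclidean norm on $\mathbb R^d$. In the weights below, the exponents in (2) and (3) are read as $0$ at $j=0$. Consider solutions $u\in\ell^2((h\mathbb Z)^d)$ of $$\Delta_{\mathrm d} u_j+V_ju_j=0,\qquad j\in\mathbb Z^d,\tag{$*$}$$ where $V:(h\mathbb Z)^d\to\mathbb C$ is bounded. 1. There exists $\mu_0=\mu_0(d)>0$ such that for all constants $M,K,A$ there is $h_0>0$ with the following property: if $0<h<h_0$ and $u$ solves $(*)$ with $\|V\|_\infty\le M$, $\|u\|_2\le K$ and $$h^d\sum_{j\in\mathbb Z^d}e^{\mu_0|jh|^{4/3}}|u_j|^2\le A,$$ then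 $u\equiv0$. 2. There exists $\mu_0=\mu_0(d)>0$ such that for every $\beta>3$ and all constants $M,K,A$ there is $h_0>0$ with the following property: if $0<h<h_0$ and $u$ solves $(*)$ with $\|V\|_\infty\le M$, $\|u\|_2\le K$ and $$h^d\sum_{j\in\mathbb Z^d}e^{\mu_0|jh|^{1+\frac1\beta}\log(|j|h)}|u_j|^2\le A,$$ then $u\equiv0$. 3. There exists $\mu_0=\mu_0(d)>0$ such that for every $h>0$: if $u\in\ell^2((h\mathbb Z)^d)$ solves $(*)$ with $V$ bounded and $$h^d\sum_{j\in\mathbb Z^d}e^{\mu_0|j|\log(|j|h)}|u_j|^2<\infty,$$ then $u\equiv0$. -/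

import Mathlib

noncomputable section

namespace LatticeLandis

/-- Complex functions on the lattice `(hℤ)^d`, written through their values `f_j = f(hj)`,
`j ∈ ℤ^d`. -/
abbrev LatticeFun (d : ℕ) : Type := (Fin d → ℤ) → ℂ

/-- The Euclidean norm `|j|` of a multi-index `j ∈ ℤ^d`. -/
def indexNorm {d : ℕ} (j : Fin d → ℤ) : ℝ :=
  ‖(WithLp.toLp 2 (fun k => (j k : ℝ)) : EuclideanSpace ℝ (Fin d))‖

/-- The discrete Laplacian on `(hℤ)^d`:
`(Δ_d f)_j = h⁻² ∑_k (f_{j+e_k} - 2 f_j + f_{j-e_k})`. -/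
def discreteLaplacian {d : ℕ} (h : ℝ) (f : LatticeFun d) : LatticeFun d :=
  fun j => (1 / (h : ℂ) ^ 2) *
    ∑ k : Fin d, (f (j + Pi.single k 1) - 2 * f j + f (j - Pi.single k 1))

/-- `u` solves the stationary discrete Schrödinger equation `Δ_d u + V u = 0` on `(hℤ)^d`. -/
def IsStationarySolution {d : ℕ} (h : ℝ) (V u : LatticeFun d) : Prop :=
  ∀ j, discreteLaplacian h u j + V j * u j = 0

/-- `V` is bounded, with `‖V‖_∞ ≤ M`. -/
def SupNormLE {d : ℕ} (V : LatticeFun d) (M : ℝ) : Prop :=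
  ∀ j, ‖V j‖ ≤ M

/-- The sum `h^d ∑_j w_j |u_j|²` converges. -/
def WeightedSumFinite {d : ℕ} (w : (Fin d → ℤ) → ℝ) (u : LatticeFun d) : Prop :=
  Summable fun j => w j * ‖u j‖ ^ 2

/-- The sum `h^d ∑_j w_j |u_j|²` converges and its value is at most `A`. -/
def WeightedSumLE {d : ℕ} (h : ℝ) (w : (Fin d → ℤ) → ℝ) (u : LatticeFun d) (A : ℝ) : Prop :=
  WeightedSumFinite w u ∧ h ^ d * ∑' j, w j * ‖u j‖ ^ 2 ≤ A

/-- `u ∈ ℓ²((hℤ)^d)`. -/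
def MemL2 {d : ℕ} (u : LatticeFun d) : Prop :=
  Summable fun j => ‖u j‖ ^ 2

/-- `u ∈ ℓ²((hℤ)^d)` and `‖u‖₂ = (h^d ∑_j |u_j|²)^{1/2} ≤ K`. -/
def L2NormLE {d : ℕ} (h : ℝ) (u : LatticeFun d) (K : ℝ) : Prop :=
  MemL2 u ∧ Real.sqrt (h ^ d * ∑' j, ‖u j‖ ^ 2) ≤ K

end LatticeLandis

end

/-!
Solve the equation at `j + e_m` for the value `u_j`, the only one in it off the half-space
`{i | i_m > j_m}`: this bounds `|u_j|` by `q = 4d - 1 + h²‖V‖_∞` times the supremum of `|u|` over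
that half-space. Going down one layer thus costs at most a factor `q`, so a solution with
`q^{j_m} |u_j| → 0` as `j_m → ∞` vanishes. The terms of a convergent sum `∑ e^{φ(j)} |u_j|²` tend
to `0`, which gives this decay as soon as `φ(j) ≥ 2 |j| log q` for all but finitely many `j`; all
three weights grow faster than every exponential.
-/

open Filter Topology

namespace LatticeLandis

variable {d : ℕ} {h M : ℝ} {V u : LatticeFun d}

lemma norm_le_indexNorm (j : Fin d → ℤ) : ‖j‖ ≤ indexNorm j := by
  refine (pi_norm_le_iff_of_nonneg (norm_nonneg _)).2 fun k => ?_
  simpa [indexNorm, Int.norm_eq_abs] using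
    PiLp.norm_apply_le (WithLp.toLp 2 (fun k => (j k : ℝ)) : EuclideanSpace ℝ (Fin d)) k

lemma apply_le_indexNorm (j : Fin d → ℤ) (m : Fin d) : (j m : ℝ) ≤ indexNorm j :=
  calc (j m : ℝ) ≤ ‖j m‖ := by simpa [Int.norm_eq_abs] using le_abs_self (j m : ℝ)
    _ ≤ ‖j‖ := norm_le_pi_norm j m
    _ ≤ indexNorm j := norm_le_indexNorm j

lemma tendsto_indexNorm_cofinite_atTop :
    Tendsto (indexNorm : (Fin d → ℤ) → ℝ) cofinite atTop := by
  rw [← cocompact_eq_cofinite]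
  exact tendsto_atTop_mono norm_le_indexNorm tendsto_norm_cocompact_atTop

lemma tendsto_indexNorm_mul_cofinite_atTop (hh : 0 < h) :
    Tendsto (fun j : Fin d → ℤ => indexNorm j * h) cofinite atTop :=
  tendsto_indexNorm_cofinite_atTop.atTop_mul_const hh

lemma comap_apply_atTop_le_cofinite (m : Fin d) :
    comap (fun j : Fin d → ℤ => j m) atTop ≤ cofinite := by
  rw [le_cofinite_iff_compl_singleton_mem]
  intro i
  filter_upwards [tendsto_comap.eventually_gt_atTop (i m)] with j hj
  rintro rfl
  exact hj.false

lemma SupNormLE.nonneg (hV : SupNormLE V M) : 0 ≤ M :=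
  (norm_nonneg _).trans (hV 0)

/-- The constant `q = 4d - 1 + h²M` of the unique continuation argument: for a solution with
`‖V‖_∞ ≤ M`, the supremum of `|u|` over a half-space `{j_m ≥ n}` is at most `q` times its
supremum over `{j_m ≥ n + 1}`. -/
noncomputable def layerFactor (d : ℕ) (h M : ℝ) : ℝ :=
  4 * d - 1 + h ^ 2 * M

lemma one_le_layerFactor (hd : 1 ≤ d) (hM : 0 ≤ M) : 1 ≤ layerFactor d h M := by
  have hd' : (1 : ℝ) ≤ d := by exact_mod_cast hd
  have : 0 ≤ h ^ 2 * M := by positivity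
  unfold layerFactor
  linarith

namespace IsStationarySolution

lemma eq_of_forward (hh : h ≠ 0) (hu : IsStationarySolution h V u) (m : Fin d)
    (j : Fin d → ℤ) :
    u j = (2 * d - (h : ℂ) ^ 2 * V (j + Pi.single m 1)) * u (j + Pi.single m 1)
      - ∑ k : Fin d, u (j + Pi.single m 1 + Pi.single k 1)
      - ∑ k ∈ Finset.univ.erase m, u (j + Pi.single m 1 - Pi.single k 1) := by
  have heq := hu (j + Pi.single m 1)
  have hhc : (h : ℂ) ≠ 0 := by exact_mod_cast hh
  simp only [discreteLaplacian, Finset.sum_add_distrib, Finset.sum_sub_distrib,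
    Finset.sum_const, Finset.card_univ, Fintype.card_fin, nsmul_eq_mul] at heq
  have hsplit := Finset.add_sum_erase Finset.univ
    (fun k : Fin d => u (j + Pi.single m 1 - Pi.single k 1)) (Finset.mem_univ m)
  rw [add_sub_cancel_right] at hsplit
  field_simp at heq
  linear_combination heq + hsplit

lemma norm_le_layerFactor_mul (hh : h ≠ 0) (hV : SupNormLE V M)
    (hu : IsStationarySolution h V u) (m : Fin d) {j : Fin d → ℤ} {E : ℝ}
    (hE : ∀ i : Fin d → ℤ, j m < i m → ‖u i‖ ≤ E) :
    ‖u j‖ ≤ layerFactor d h M * E := by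
  have hM := hV.nonneg
  have hcoef : ‖2 * d - (h : ℂ) ^ 2 * V (j + Pi.single m 1)‖ ≤ 2 * d + h ^ 2 * M := by
    refine (norm_sub_le _ _).trans (add_le_add (by simp) ?_)
    rw [norm_mul, norm_pow, Complex.norm_real, Real.norm_eq_abs, sq_abs]
    exact mul_le_mul_of_nonneg_left (hV _) (sq_nonneg h)
  have hcenter : ‖(2 * d - (h : ℂ) ^ 2 * V (j + Pi.single m 1)) * u (j + Pi.single m 1)‖
      ≤ (2 * d + h ^ 2 * M) * E := by
    rw [norm_mul]
    exact mul_le_mul hcoef (hE _ (by simp)) (norm_nonneg _) (by positivity)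
  have hforward : ‖∑ k : Fin d, u (j + Pi.single m 1 + Pi.single k 1)‖ ≤ d * E := by
    refine (norm_sum_le_of_le _ fun k _ => hE _ ?_).trans (by simp)
    have hk : (0 : Fin d → ℤ) ≤ Pi.single k 1 := Pi.single_nonneg.2 zero_le_one
    calc j m < (j + Pi.single m 1 : Fin d → ℤ) m := by simp
      _ ≤ (j + Pi.single m 1 + Pi.single k 1 : Fin d → ℤ) m := le_add_of_nonneg_right hk m
  have hbackward : ‖∑ k ∈ Finset.univ.erase m, u (j + Pi.single m 1 - Pi.single k 1)‖
      ≤ (d - 1) * E := by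
    refine (norm_sum_le_of_le _ fun k hk => hE _ ?_).trans_eq ?_
    · simp [Pi.single_eq_of_ne (Finset.ne_of_mem_erase hk).symm]
    · simp [Finset.card_erase_of_mem, Nat.cast_sub m.pos]
  calc ‖u j‖ ≤ (2 * d + h ^ 2 * M) * E + d * E + (d - 1) * E := by
        rw [hu.eq_of_forward hh m j]
        exact norm_sub_le_of_le (norm_sub_le_of_le hcenter hforward) hbackward
    _ = layerFactor d h M * E := by unfold layerFactor; ring

lemma zpow_mul_norm_le_of_forall_ge (hh : h ≠ 0) (hV : SupNormLE V M)
    (hu : IsStationarySolution h V u) (m : Fin d) {N : ℤ} {ε : ℝ}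
    (hN : ∀ i : Fin d → ℤ, N ≤ i m → layerFactor d h M ^ i m * ‖u i‖ ≤ ε) (j : Fin d → ℤ) :
    layerFactor d h M ^ j m * ‖u j‖ ≤ ε := by
  set q := layerFactor d h M
  have hq : 1 ≤ q := one_le_layerFactor m.pos hV.nonneg
  have hq₀ : 0 < q := one_pos.trans_le hq
  rcases le_total N (j m) with hj | hj
  · exact hN j hj
  suffices H : ∀ n ≤ N, ∀ i : Fin d → ℤ, n ≤ i m → q ^ i m * ‖u i‖ ≤ ε from
    H (j m) hj j le_rfl
  intro n hn
  induction n, hn using Int.leInductionDown with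
  | base => exact hN
  | pred n _ ih =>
    intro i hi
    have hnext : ∀ l : Fin d → ℤ, i m < l m → ‖u l‖ ≤ ε / q ^ (i m + 1) := fun l hl => by
      rw [le_div_iff₀' (by positivity)]
      calc q ^ (i m + 1) * ‖u l‖ ≤ q ^ l m * ‖u l‖ := by gcongr; exact hl
        _ ≤ ε := ih l (by lia)
    calc q ^ i m * ‖u i‖ ≤ q ^ i m * (q * (ε / q ^ (i m + 1))) := by
          gcongr
          exact hu.norm_le_layerFactor_mul hh hV m hnext
      _ = ε := by rw [zpow_add_one₀ hq₀.ne']; field_simp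

lemma eq_zero_of_tendsto_zpow_mul_norm (hh : h ≠ 0) (hV : SupNormLE V M)
    (hu : IsStationarySolution h V u) (m : Fin d)
    (hlim : Tendsto (fun j => layerFactor d h M ^ j m * ‖u j‖)
      (comap (fun j : Fin d → ℤ => j m) atTop) (𝓝 0)) : u = 0 := by
  have hq : 0 < layerFactor d h M := one_pos.trans_le (one_le_layerFactor m.pos hV.nonneg)
  funext j
  have hj : layerFactor d h M ^ j m * ‖u j‖ ≤ 0 := by
    refine le_of_forall_pos_le_add fun ε hε => ?_
    obtain ⟨N, hN⟩ := eventually_atTop.1 (eventually_comap.1 (hlim.eventually_le_const hε))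
    rw [zero_add]
    exact hu.zpow_mul_norm_le_of_forall_ge hh hV m (fun i hi => hN (i m) hi i rfl) j
  exact norm_le_zero_iff.1 (nonpos_of_mul_nonpos_right hj (by positivity))

end IsStationarySolution

lemma WeightedSumFinite.tendsto_zpow_mul_norm {φ : (Fin d → ℤ) → ℝ}
    (hw : WeightedSumFinite (fun j => Real.exp (φ j)) u) {q : ℝ} (hq : 1 ≤ q)
    (hφ : ∀ᶠ j in cofinite, 2 * Real.log q * indexNorm j ≤ φ j) (m : Fin d) :
    Tendsto (fun j => q ^ j m * ‖u j‖) cofinite (𝓝 0) := by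
  have hsq : Tendsto (fun j => (q ^ j m * ‖u j‖) ^ 2) cofinite (𝓝 0) := by
    refine squeeze_zero' (.of_forall fun j => sq_nonneg _) ?_ hw.tendsto_cofinite_zero
    filter_upwards [hφ] with j hj
    have hexp : (q ^ j m) ^ 2 = Real.exp (2 * Real.log q * j m) := by
      rw [← Real.rpow_intCast, Real.rpow_def_of_pos (by positivity), ← Real.exp_nat_mul]
      ring_nf
    rw [mul_pow, hexp]
    gcongr
    calc 2 * Real.log q * j m ≤ 2 * Real.log q * indexNorm j := by
          have := Real.log_nonneg hq
          gcongr
          exact apply_le_indexNorm j m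
      _ ≤ φ j := hj
  have hsqrt (j : Fin d → ℤ) : √((q ^ j m * ‖u j‖) ^ 2) = q ^ j m * ‖u j‖ :=
    Real.sqrt_sq (by positivity)
  simpa only [hsqrt, Real.sqrt_zero] using hsq.sqrt

lemma eventually_mul_le_rpow {p : ℝ} (hp : 1 < p) (c : ℝ) :
    ∀ᶠ s : ℝ in atTop, c * s ≤ s ^ p := by
  filter_upwards [(tendsto_rpow_atTop (sub_pos.2 hp)).eventually_ge_atTop c,
    eventually_gt_atTop 0] with s hc hs
  calc c * s ≤ s ^ (p - 1) * s := by gcongr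
    _ = s ^ p := by rw [← Real.rpow_add_one hs.ne', sub_add_cancel]

lemma eventually_mul_le_rpow_mul_log {p : ℝ} (hp : 1 ≤ p) (c : ℝ) :
    ∀ᶠ s : ℝ in atTop, c * s ≤ s ^ p * Real.log s := by
  filter_upwards [Real.tendsto_log_atTop.eventually_ge_atTop c, eventually_ge_atTop 1]
    with s hc hs
  calc c * s ≤ s * Real.log s := by rw [mul_comm]; gcongr
    _ ≤ s ^ p * Real.log s := by
      have := Real.log_nonneg hs
      gcongr
      exact Real.self_le_rpow_of_one_le hs hp

lemma eventually_mul_indexNorm_le {g : ℝ → ℝ} (hg : ∀ c : ℝ, ∀ᶠ s in atTop, c * s ≤ g s)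
    (hh : 0 < h) (c : ℝ) :
    ∀ᶠ j : Fin d → ℤ in cofinite, c * indexNorm j ≤ g (indexNorm j * h) := by
  filter_upwards [(tendsto_indexNorm_mul_cofinite_atTop hh).eventually (hg (c / h))] with j hj
  calc c * indexNorm j = c / h * (indexNorm j * h) := by field_simp
    _ ≤ g (indexNorm j * h) := hj

lemma eventually_mul_indexNorm_le_mul_log (hh : 0 < h) (c : ℝ) :
    ∀ᶠ j : Fin d → ℤ in cofinite,
      c * indexNorm j ≤ indexNorm j * Real.log (indexNorm j * h) := by
  filter_upwards [(Real.tendsto_log_atTop.comp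
    (tendsto_indexNorm_mul_cofinite_atTop hh)).eventually_ge_atTop c] with j hj
  rw [mul_comm]
  exact mul_le_mul_of_nonneg_left hj (norm_nonneg _)

end LatticeLandis

open LatticeLandis in
theorem theorem1p2_general {d : ℕ} (hd : 1 ≤ d) {h M : ℝ} (hh : h ≠ 0) {V u : LatticeFun d}
    (hV : SupNormLE V M) (hu : IsStationarySolution h V u) {φ : (Fin d → ℤ) → ℝ}
    (hφ : ∀ᶠ j in cofinite, 2 * Real.log (layerFactor d h M) * indexNorm j ≤ φ j)
    (hw : WeightedSumFinite (fun j => Real.exp (φ j)) u) : u = 0 := by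
  have hq : 1 ≤ layerFactor d h M := one_le_layerFactor hd hV.nonneg
  have hlim := hw.tendsto_zpow_mul_norm hq hφ ⟨0, hd⟩
  exact hu.eq_zero_of_tendsto_zpow_mul_norm hh hV ⟨0, hd⟩
    (hlim.mono_left (comap_apply_atTop_le_cofinite _))

open LatticeLandis in
theorem theorem1p2 (d : ℕ) (hd : 1 ≤ d) :
    -- (1) close-to-continuum decay
    (∃ μ₀ : ℝ, 0 < μ₀ ∧ ∀ M K A : ℝ, ∃ h₀ : ℝ, 0 < h₀ ∧
      ∀ h : ℝ, 0 < h → h < h₀ → ∀ V u : LatticeFun d,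
        SupNormLE V M → L2NormLE h u K → IsStationarySolution h V u →
        WeightedSumLE h
          (fun j => Real.exp (μ₀ * (indexNorm j * h) ^ (4 / 3 : ℝ))) u A →
        u = 0) ∧
    -- (2) interpolating decay
    (∃ μ₀ : ℝ, 0 < μ₀ ∧ ∀ β : ℝ, 3 < β → ∀ M K A : ℝ, ∃ h₀ : ℝ, 0 < h₀ ∧
      ∀ h : ℝ, 0 < h → h < h₀ → ∀ V u : LatticeFun d,
        SupNormLE V M → L2NormLE h u K → IsStationarySolution h V u →
        WeightedSumLE h
          (fun j => Real.exp (μ₀ * (indexNorm j * h) ^ (1 + 1 / β : ℝ) *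
            Real.log (indexNorm j * h))) u A →
        u = 0) ∧
    -- (3) purely discrete decay, for each fixed mesh size
    (∃ μ₀ : ℝ, 0 < μ₀ ∧ ∀ h : ℝ, 0 < h → ∀ V u : LatticeFun d,
        (∃ M : ℝ, SupNormLE V M) → MemL2 u → IsStationarySolution h V u →
        WeightedSumFinite
          (fun j => Real.exp (μ₀ * indexNorm j * Real.log (indexNorm j * h))) u →
        u = 0) := by
  refine ⟨⟨1, one_pos, fun M K A => ⟨1, one_pos, fun h hh _ V u hV _ hu hw => ?_⟩⟩,
    ⟨1, one_pos, fun β hβ M K A => ⟨1, one_pos, fun h hh _ V u hV _ hu hw => ?_⟩⟩,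
    ⟨1, one_pos, fun h hh V u ⟨M, hV⟩ _ hu hw => ?_⟩⟩
  · refine theorem1p2_general hd hh.ne' hV hu ?_ hw.1
    simpa only [one_mul] using
      eventually_mul_indexNorm_le (eventually_mul_le_rpow (by norm_num)) hh _
  · refine theorem1p2_general hd hh.ne' hV hu ?_ hw.1
    have hp : 1 ≤ 1 + 1 / β := le_add_of_nonneg_right (by positivity)
    simpa only [one_mul] using
      eventually_mul_indexNorm_le (eventually_mul_le_rpow_mul_log hp) hh _
  · refine theorem1p2_general hd hh.ne' hV hu ?_ hw
    simpa only [one_mul] using eventually_mul_indexNorm_le_mul_log hh _
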